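/- **Setup.** Let $\mathbb N=\{1,2,\dots\}$, $\mathbf x=(x_1,x_2,\dots)$, $\mathbf t=(t_1,t_2,\dots)$. An *indexed forest* is a sequence $F=(T_1,T_2,\dots)$ of plane binary trees (every internal node has a left and a right child), all but finitely many of them trivial (a single leaf); its leaves are labelled $1,2,\dots$ from left to right. Let $\mathsf{Forest}$ be the set of indexed forests and $\emptyset$ the forest with only trivial trees. $\mathsf{Forest}$ is a monoid: $F\cdot G$ is obtained by attaching, for each $i$, the $i$-th leaf of $F$ to the root of the $i$-th tree of $G$. It is generated by the elementary forests $\underline i$, whose only internal node has children the leaves $i,i+1$; a *factorization* $F=i_1\cdots i_k$ is an expression $F=\underline{i_1}\cdots\underline{i_k}$. A node is *terminal* if both its children are leaves, $\operatorname{QDes}(F)$ is the set of labels of the left children of the terminal nodes of $F$, and for $i\in\operatorname{QDes}(F)$ the forest $F/i$ is obtained by deleting the corresponding terminal node (turning it into a leaf). For a finite $A\subset\mathbb N$ let $\overline A_1<\overline A_2<\cdots$ be the elements of $\mathbb N\setminus A$, $t_{i,A}=t_{\overline A_i}$, $\widehat{\mathbf t}_A=(t_{1,A},t_{2,A},\dots)$,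 and $i\star A=\{\overline A_i\}\cup A$; write $i_1\star\cdots\star i_k\star A=i_1\star(i_2\star(\cdots\star(i_k\star A)))$. For $f\in\mathbb Z[\mathbf t][\mathbf x]$ put $\operatorname{ev}_Af=f(\widehat{\mathbf t}_A;\mathbf t)$ and $$E_{i,A}f=\frac{f(x_1,\dots,x_i,t_{i,A},x_{i+1},\dots;\mathbf t)-f(x_1,\dots,x_{i-1},t_{i,A},x_i,\dots;\mathbf t)}{x_i-t_{i,A}}\in\mathbb Z[\mathbf t][\mathbf x].$$ For a word $i_1,\dots,i_k$ put $$[\operatorname{ev}\star E_{i_1}\star\cdots\star E_{i_k}]=\operatorname{ev}_{i_1\star\cdots\star i_k\star\emptyset}\;E_{i_1,\,i_2\star\cdots\star i_k\star\emptyset}\;E_{i_2,\,i_3\star\cdots\star i_k\star\emptyset}\cdots E_{i_k,\emptyset}:\ \mathbb Z[\mathbf t][\mathbf x]\to\mathbb Z[\mathbf t].$$ **Theorem.** 1. There is a unique family $(\mathfrak P_F)_{F\in\mathsf{Forest}}$ of homogeneous polynomials in $\mathbb Z[\mathbf t][\mathbf x]$ (homogeneous jointly in $\mathbf x$ and $\mathbf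 t$), the *double forest polynomials*, such that for all $F$ and $i$: $\mathfrak P_\emptyset(\mathbf t;\mathbf t)=1$ and $\mathfrak P_F(\mathbf t;\mathbf t)=0$ if $F\ne\emptyset$; and $E_{i,\emptyset}\mathfrak P_F=\mathfrak P_{F/i}(\mathbf x;\widehat{\mathbf t}_{\{i\}})$ if $i\in\operatorname{QDes}(F)$, while $E_{i,\emptyset}\mathfrak P_F=0$ otherwise. 2. For $F\in\mathsf{Forest}$ the operator $[\operatorname{ev}\star E_F]:=[\operatorname{ev}\star E_{i_1}\star\cdots\star E_{i_k}]$ does not depend on the choice of the factorization $F=i_1\cdots i_k$. 3. For every $f\in\mathbb Z[\mathbf t][\mathbf x]$ only finitely many of the polynomials $a_F=[\operatorname{ev}\star E_F]f\in\mathbb Z[\mathbf t]$, $F\in\mathsf{Forest}$, are nonzero, and $$f=\sum_{F\in\mathsf{Forest}}a_F\,\mathfrak P_F.$$ -/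

import Mathlib

/-! Conventions. The positive integers are shifted down by one: leaves, roots and variables are
indexed by `0, 1, 2, …`, so that `X i` is `x_{i+1}` and the coefficient variable `X i` is `t_{i+1}`. All
relations and definitions below are invariant under this shift. -/

namespace DoubleForest

/-- Plane binary trees: `.nil` is the trivial tree (a single leaf), and `.node () l r` is an internal
node with left child `l` and right child `r`. -/
abbrev PlaneTree : Type := BinaryTree Unit

/-- An indexed forest: a sequence of plane binary trees, all but finitely many of them trivial. -/
@[ext]
structure IndexedForest where
  tree : ℕ → PlaneTree
  finite : {k | tree k ≠ .nil}.Finite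

/-- The label of the leftmost leaf of the `k`-th tree of a sequence of trees, when all leaves are
labelled `0, 1, 2, …` from left to right. -/
def firstLeaf (G : ℕ → PlaneTree) (k : ℕ) : ℕ := ∑ j ∈ Finset.range k, (G j).numLeaves

theorem firstLeaf_succ (G : ℕ → PlaneTree) (k : ℕ) :
    firstLeaf G (k + 1) = firstLeaf G k + (G k).numLeaves := Finset.sum_range_succ _ _

theorem firstLeaf_strictMono (G : ℕ → PlaneTree) : StrictMono (firstLeaf G) :=
  strictMono_nat_of_lt_succ fun k => by
    rw [firstLeaf_succ]; exact Nat.lt_add_of_pos_right (G k).numLeaves_pos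

/-- For a tree whose leaves are labelled `s, s + 1, …` from left to right, attach the root of `G j` to
the leaf labelled `j`. -/
def graft (G : ℕ → PlaneTree) : PlaneTree → ℕ → PlaneTree
  | .nil, s => G s
  | .node _ l r, s => .node () (graft G l s) (graft G r (s + l.numLeaves))

theorem firstLeaf_graft (G : ℕ → PlaneTree) (T : PlaneTree) (s : ℕ) :
    firstLeaf G s + (graft G T s).numLeaves = firstLeaf G (s + T.numLeaves) := by
  induction T generalizing s with
  | nil => simp [graft, BinaryTree.numLeaves, firstLeaf_succ]
  | node _ l r hl hr =>
    simp only [graft, BinaryTree.numLeaves]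
    rw [← add_assoc, hl, hr, add_assoc]

theorem graft_graft (G H : ℕ → PlaneTree) (T : PlaneTree) (s : ℕ) :
    graft H (graft G T s) (firstLeaf G s) =
      graft (fun k => graft H (G k) (firstLeaf G k)) T s := by
  induction T generalizing s with
  | nil => rfl
  | node _ l r hl hr => simp only [graft, hl, firstLeaf_graft, hr]

theorem graft_nil (T : PlaneTree) (s : ℕ) : graft (fun _ => .nil) T s = T := by
  induction T generalizing s with
  | nil => rfl
  | node _ l r hl hr => simp [graft, hl, hr]

namespace IndexedForest

/-- The empty forest: all trees are trivial. -/
instance : One IndexedForest := ⟨⟨fun _ => .nil, by simp⟩⟩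

/-- The product `F * G`: for each `i`, the `i`-th leaf of `F` is attached to the `i`-th root of `G`. -/
instance : Mul IndexedForest where
  mul F G :=
    { tree := fun k => graft G.tree (F.tree k) (firstLeaf F.tree k)
      finite := by
        refine (F.finite.union (G.finite.preimage
          (f := firstLeaf F.tree) (firstLeaf_strictMono _).injective.injOn)).subset ?_
        intro k hk
        by_cases h : F.tree k = .nil
        · right
          simpa [h, graft] using hk
        · exact Or.inl h }

theorem one_tree : (1 : IndexedForest).tree = fun _ => .nil := rfl

theorem mul_tree (F G : IndexedForest) :
    (F * G).tree = fun k => graft G.tree (F.tree k) (firstLeaf F.tree k) := rfl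

theorem firstLeaf_mul (F G : IndexedForest) (k : ℕ) :
    firstLeaf (F * G).tree k = firstLeaf G.tree (firstLeaf F.tree k) := by
  induction k with
  | zero => simp [firstLeaf]
  | succ k ih =>
    rw [firstLeaf_succ, ih, mul_tree]
    dsimp only
    rw [firstLeaf_graft, ← firstLeaf_succ]

/-- Indexed forests form a monoid. -/
instance : Monoid IndexedForest where
  mul_assoc F G H := by
    ext1; funext k
    rw [mul_tree (F * G), mul_tree F (G * H)]
    dsimp only
    rw [firstLeaf_mul, mul_tree, mul_tree]
    exact graft_graft _ _ _ _
  one_mul F := by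
    ext1; funext k
    rw [mul_tree, one_tree]
    simp [graft, firstLeaf, BinaryTree.numLeaves]
  mul_one F := by
    ext1; funext k
    rw [mul_tree, one_tree]
    exact graft_nil _ _

/-- The `i`-th elementary forest: its only internal node has the leaf `i` as left child
and the leaf `i + 1` as right child. -/
def elementary (i : ℕ) : IndexedForest where
  tree k := if k = i then .node () .nil .nil else .nil
  finite := (Set.finite_singleton i).subset fun k hk => by
    by_contra h
    have h' : k ≠ i := h
    simp [h'] at hk

/-- The words `i₁, …, i_k` that are factorizations `F = i₁ ⋯ i_k` of `F` into elementary forests. -/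
def trimmingWords (F : IndexedForest) : Set (List ℕ) :=
  {w | (w.map elementary).prod = F}

theorem elementary_mul (i : ℕ) (G : IndexedForest) :
    (elementary i * G).tree = fun k => if k < i then G.tree k else
      if k = i then .node () (G.tree i) (G.tree (i + 1)) else G.tree (k + 1) := by
  have key : ∀ k, firstLeaf (elementary i).tree k = if k ≤ i then k else k + 1 := by
    intro k
    induction k with
    | zero => simp [firstLeaf]
    | succ k ih =>
      rw [firstLeaf_succ, ih]
      by_cases h : k = i
      · simp [elementary, h, BinaryTree.numLeaves]
      · simp only [elementary, h, if_false, BinaryTree.numLeaves]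
        split_ifs <;> omega
  funext k
  rw [mul_tree]
  dsimp only
  rw [key]
  rcases lt_trichotomy k i with h | h | h
  · simp [elementary, h, h.ne, h.le, graft]
  · subst h
    simp [elementary, graft, BinaryTree.numLeaves]
  · simp [elementary, h.ne', h.not_ge, h.not_gt, graft]

/-- The elementary forests generate the monoid of indexed forests. -/
theorem trimmingWords_nonempty (F : IndexedForest) : F.trimmingWords.Nonempty := by
  -- claim for a forest made of `k` trivial trees, the trees of a list `L`, and trivial trees
  have main : ∀ (n k : ℕ) (L : List PlaneTree),
      (L.map fun T : PlaneTree => 2 * T.numNodes + 1).sum ≤ n →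
      ∀ F : IndexedForest, (∀ j < k, F.tree j = .nil) →
        (∀ j, F.tree (k + j) = L.getD j .nil) → F.trimmingWords.Nonempty := by
    intro n
    induction n with
    | zero =>
      intro k L hL F h1 h2
      have hnil : L = [] := by
        cases L with
        | nil => rfl
        | cons T L => simp at hL
      refine ⟨[], ?_⟩
      have : F = 1 := by
        ext1; funext j
        rw [one_tree]
        rcases lt_or_ge j k with h | h
        · exact h1 j h
        · obtain ⟨m, rfl⟩ := Nat.exists_eq_add_of_le h
          rw [h2, hnil]; rfl
      simp [trimmingWords, this]
    | succ n ih =>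
      intro k L hL F h1 h2
      match L, hL, h2 with
      | [], _, h2 => exact ih k [] (by simp) F h1 h2
      | .nil :: L, hL, h2 =>
        refine ih (k + 1) L ?_ F ?_ ?_
        · simp only [List.map_cons, List.sum_cons] at hL; omega
        · intro j hj
          rcases Nat.lt_succ_iff_lt_or_eq.1 hj with h | rfl
          · exact h1 j h
          · simpa using h2 0
        · intro j
          have := h2 (j + 1)
          rw [show k + 1 + j = k + (j + 1) by ring, this]; rfl
      | .node u l r :: L, hL, h2 =>
        let F' : IndexedForest :=
          { tree := fun j => if j < k then .nil else (l :: r :: L).getD (j - k) .nil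
            finite := (Set.finite_lt_nat (k + (l :: r :: L).length)).subset fun j hj => by
              by_contra hcon
              have h3 : ¬ j < k + (l :: r :: L).length := hcon
              apply hj
              show (if j < k then _ else _) = _
              rw [if_neg (by omega)]
              exact List.getD_eq_default _ _ (by omega) }
        have hF : F = elementary k * F' := by
          ext1
          rw [elementary_mul]
          funext j
          rcases lt_trichotomy j k with h | h | h
          · simp [h, h1, F']
          · subst h
            have := h2 0
            simp only [add_zero, List.getD_cons_zero] at this
            simp [F', this]
          · obtain ⟨m, rfl⟩ := Nat.exists_eq_add_of_lt h
            have h4 := h2 (m + 1)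
            rw [add_assoc, h4]
            simp [F', show k + (m + 1) + 1 - k = m + 2 by omega]
            omega
        obtain ⟨w, hw⟩ := ih k (l :: r :: L) (by
          simp only [List.map_cons, List.sum_cons, BinaryTree.numNodes] at hL ⊢
          omega) F' (fun j hj => by simp [F', hj]) (fun j => by simp [F'])
        refine ⟨k :: w, ?_⟩
        have hw' : (w.map elementary).prod = F' := hw
        simp [trimmingWords, hw', hF]
  obtain ⟨N, hN⟩ := F.finite.bddAbove
  refine main _ 0 ((List.range (N + 1)).map F.tree) le_rfl F (by simp) fun j => ?_
  rw [zero_add]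
  rcases lt_or_ge j (N + 1) with h | h
  · simp [h]
  · rw [List.getD_eq_default _ _ (by simpa using h)]
    by_contra hj
    have := hN hj
    omega

end IndexedForest

/-- For a tree whose leaves are labelled `s, s + 1, …`: the labels of the terminal nodes (the internal
nodes both of whose children are leaves), the label of a terminal node being that of its left child,
i.e. of the leaf reached from it by going down left edges. -/
def terminalLabels : PlaneTree → ℕ → Set ℕ
  | .nil, _ => ∅
  | .node _ l r, s => {i | l = .nil ∧ r = .nil ∧ s = i} ∪
      (terminalLabels l s ∪ terminalLabels r (s + l.numLeaves))

/-- For a tree whose leaves are labelled `s, s + 1, …`: delete the terminal node with label `i` (so that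
it becomes a leaf), if there is one. -/
def deleteTerminal (i : ℕ) : PlaneTree → ℕ → PlaneTree
  | .nil, _ => .nil
  | .node _ l r, s =>
      if l = .nil ∧ r = .nil ∧ s = i then .nil
      else .node () (deleteTerminal i l s) (deleteTerminal i r (s + l.numLeaves))

namespace IndexedForest

/-- The set `QDes(F)` of labels of the terminal nodes of `F`. -/
def qDes (F : IndexedForest) : Set ℕ :=
  {i | ∃ k, i ∈ terminalLabels (F.tree k) (firstLeaf F.tree k)}

/-- The trimmed forest `F / i`: the terminal node of `F` with label `i` is deleted. -/
def trim (F : IndexedForest) (i : ℕ) : IndexedForest where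
  tree k := deleteTerminal i (F.tree k) (firstLeaf F.tree k)
  finite := F.finite.subset fun k hk h => hk (by simp [h, deleteTerminal])

end IndexedForest

open MvPolynomial

/-- The ring `ℤ[t]`. -/
abbrev CoeffRing : Type := MvPolynomial ℕ ℤ

/-- The ring `ℤ[t][x]`. -/
abbrev PolyRing : Type := MvPolynomial ℕ CoeffRing

/-- `complNth A i` is the `i`-th element of the complement of the finite set `A`, in increasing order. -/
noncomputable def complNth (A : Finset ℕ) (i : ℕ) : ℕ := Nat.nth (fun n => n ∉ A) i

/-- The variable `t_{i,A}`, the `i`-th term of the sequence `t̂_A` of those `t_j` with `j ∉ A`. -/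
noncomputable def tHat (A : Finset ℕ) (i : ℕ) : CoeffRing := X (complNth A i)

/-- `ev_A f = f(t̂_A; t)`. -/
noncomputable def evA (A : Finset ℕ) : PolyRing →ₐ[CoeffRing] CoeffRing := aeval (tHat A)

/-- The reindexing `f(x; t) ↦ f(x; t̂_A)` of the equivariant variables. -/
noncomputable def substT (A : Finset ℕ) : PolyRing →+* PolyRing :=
  MvPolynomial.map (rename (complNth A) : CoeffRing →ₐ[ℤ] CoeffRing).toRingHom

/-- The equivariant Bergeron–Sottile map
`R⁻_{i,A} f = f(x_1, …, x_{i-1}, t_{i,A}, x_i, x_{i+1}, …; t)`. -/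
noncomputable def rMinus (i : ℕ) (A : Finset ℕ) : PolyRing →ₐ[CoeffRing] PolyRing :=
  aeval fun j => if j < i then X j else if j = i then C (tHat A i) else X (j - 1)

/-- The equivariant Bergeron–Sottile map
`R⁺_{i,A} f = f(x_1, …, x_{i-1}, x_i, t_{i,A}, x_{i+1}, …; t)`. -/
noncomputable def rPlus (i : ℕ) (A : Finset ℕ) : PolyRing →ₐ[CoeffRing] PolyRing :=
  aeval fun j => if j < i + 1 then X j else if j = i + 1 then C (tHat A i) else X (j - 1)

theorem dvd_rPlus_sub_rMinus (i : ℕ) (A : Finset ℕ) (f : PolyRing) :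
    (X i - C (tHat A i) : PolyRing) ∣ rPlus i A f - rMinus i A f := by
  induction f using MvPolynomial.induction_on with
  | C a => simp [rPlus, rMinus]
  | add p q hp hq =>
    rw [map_add, map_add, add_sub_add_comm]
    exact dvd_add hp hq
  | mul_X p j hp =>
    have hX : (X i - C (tHat A i) : PolyRing) ∣ rPlus i A (X j) - rMinus i A (X j) := by
      simp only [rPlus, rMinus, aeval_X]
      rcases lt_trichotomy j i with h | rfl | h
      · simp [h, h.trans (Nat.lt_succ_self i)]
      · simp
      · rcases Nat.eq_or_lt_of_le h with rfl | h2
        · simp only [lt_irrefl, if_false, if_true, Nat.succ_eq_add_one, Nat.add_sub_cancel]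
          rw [if_neg (by omega), if_neg (by omega)]
          exact ⟨-1, by ring⟩
        · rw [if_neg (by omega), if_neg (by omega), if_neg (by omega), if_neg (by omega)]
          simp
    rw [map_mul, map_mul, show rPlus i A p * rPlus i A (X j) - rMinus i A p * rMinus i A (X j) =
      rPlus i A p * (rPlus i A (X j) - rMinus i A (X j)) +
        (rPlus i A p - rMinus i A p) * rMinus i A (X j) by ring]
    exact dvd_add (hX.mul_left _) (hp.mul_right _)

/-- The equivariant trimming operation `E_{i,A} f = (R⁺_{i,A} f - R⁻_{i,A} f) / (x_i - t_{i,A})`;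
the polynomial division is exact. -/
noncomputable def trimOp (i : ℕ) (A : Finset ℕ) (f : PolyRing) : PolyRing :=
  (dvd_rPlus_sub_rMinus i A f).choose

theorem mul_trimOp (i : ℕ) (A : Finset ℕ) (f : PolyRing) :
    (X i - C (tHat A i)) * trimOp i A f = rPlus i A f - rMinus i A f :=
  (dvd_rPlus_sub_rMinus i A f).choose_spec.symm

/-- The product `B ⋆ A = {the i-th element of the complement of A | i ∈ B} ∪ A` of finite sets. -/
noncomputable def starSet (B A : Finset ℕ) : Finset ℕ := B.image (complNth A) ∪ A

/-- For `w = i₁, …, i_k`: the finite set `i₁ ⋆ ⋯ ⋆ i_k ⋆ A`. -/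
noncomputable def starWeight (w : List ℕ) (A : Finset ℕ) : Finset ℕ :=
  w.foldr (fun i B => starSet {i} B) A

/-- For `w = i₁, …, i_k`: the `⋆`-composition
`[E_{i₁} ⋆ ⋯ ⋆ E_{i_k}]_A = E_{i₁, i₂ ⋆ ⋯ ⋆ i_k ⋆ A} E_{i₂, i₃ ⋆ ⋯ ⋆ i_k ⋆ A} ⋯ E_{i_k, A}`. -/
noncomputable def starComp (A : Finset ℕ) : List ℕ → PolyRing → PolyRing
  | [], f => f
  | i :: w, f => trimOp i (starWeight w A) (starComp A w f)

/-- For `w = i₁, …, i_k`: the operation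
`[ev ⋆ E_{i₁} ⋆ ⋯ ⋆ E_{i_k}]_A = ev_{i₁ ⋆ ⋯ ⋆ i_k ⋆ A} [E_{i₁} ⋆ ⋯ ⋆ E_{i_k}]_A`. -/
noncomputable def evStar (A : Finset ℕ) (w : List ℕ) (f : PolyRing) : CoeffRing :=
  evA (starWeight w A) (starComp A w f)

/-- The extraction operator `[ev ⋆ E_F] = [ev ⋆ E_{i₁} ⋆ ⋯ ⋆ E_{i_k}]` for a factorization
`F = i₁ ⋯ i_k` of `F`. -/
noncomputable def evStarForest (F : IndexedForest) (f : PolyRing) : CoeffRing :=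
  evStar ∅ F.trimmingWords_nonempty.choose f

/-- A polynomial in `ℤ[t][x]` is homogeneous if it is homogeneous as a polynomial in all the
variables `x` and `t` jointly. -/
def IsHomog (f : PolyRing) : Prop :=
  ∃ d : ℕ, ((sumAlgEquiv ℤ ℕ ℕ).symm f).IsHomogeneous d

open Classical in
/-- The properties that characterize the family of double forest polynomials: they are
homogeneous, `𝔓_F(t; t)` is `1` if `F` is empty and `0` otherwise, and `E_i 𝔓_F` is `𝔓_{F/i}(x; t̂_i)` if
`i ∈ QDes(F)` and `0` otherwise. -/
structure IsDoubleForestFamily (P : IndexedForest → PolyRing) : Prop where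
  homogeneous : ∀ F, IsHomog (P F)
  normalization : ∀ F, evA ∅ (P F) = if F = 1 then 1 else 0
  recursion : ∀ F i, trimOp i ∅ (P F) = if i ∈ F.qDes then substT {i} (P (F.trim i)) else 0

/-- The double forest polynomials `𝔓_F`: the family with the characterizing properties. (It is part
of the claim below that there is one and only one such family.) -/
noncomputable def doubleForest : IndexedForest → PolyRing :=
  Classical.epsilon IsDoubleForestFamily

end DoubleForest

open DoubleForest

/-! Everything is read off from the functionals `evStar A w`: trim along the word `w`, then
evaluate. For `j < i` the elementary forests satisfy `i · j = j · (i + 1)`, and these relations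
present the forest monoid (`word_induction`). The ⋆-composed trimming operators satisfy the same
relations (`trimOp_comm`), so the functionals depend only on the forest that `w` factorizes.

The functionals separate polynomials (`eq_of_evStar_eq`): a polynomial killed by every `E_i`
involves no `x`, and each `E_i` lowers the joint degree by one. Since `G · i = F` exactly when `i ∈
QDes(F)` and `G = F / i`, the defining recursion unwinds to the duality `[ev ⋆ E_G] 𝔓_F = δ_{G,F}`
(`IsDualTo`), whence uniqueness. The expansion also follows by separation once the sum is finite:
long words exhaust the degree, and letters beyond the variables of `f` kill it.

Existence is an integration problem, solved by induction on the length of a factorization: find `f`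
with `E_i f = 𝔓_{F/i}(x; t̂_i)` where `i ∈ QDes(F)` and `E_i f = 0` elsewhere. The commutation
relations are the only obstruction (`exists_trimOp_eq`), and the right-hand sides satisfy them
because their functionals agree. Subtracting a constant normalizes `f`. -/

namespace DoubleForest

/-! ### Trees: attaching an elementary forest and deleting a terminal node -/

theorem firstLeaf_elementary (j k : ℕ) :
    firstLeaf (IndexedForest.elementary j).tree k = if k ≤ j then k else k + 1 := by
  induction k with
  | zero => simp [firstLeaf]
  | succ k ih =>
    rw [firstLeaf_succ, ih]
    by_cases h : k = j
    · simp [IndexedForest.elementary, h, BinaryTree.numLeaves]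
    · simp only [IndexedForest.elementary, h, if_false, BinaryTree.numLeaves]
      split_ifs <;> omega

theorem graft_elementary_eq_self (j : ℕ) (T : PlaneTree) (s : ℕ)
    (h : j < s ∨ s + T.numLeaves ≤ j) : graft (IndexedForest.elementary j).tree T s = T := by
  induction T generalizing s with
  | nil =>
    have : s ≠ j := by simp only [BinaryTree.numLeaves] at h; omega
    simp [graft, IndexedForest.elementary, this]
  | node _ l r hl hr =>
    simp only [BinaryTree.numLeaves] at h
    simp only [graft]
    rw [hl s (by omega), hr _ (by omega)]

theorem terminalLabels_bounds {j : ℕ} {T : PlaneTree} {s : ℕ} (h : j ∈ terminalLabels T s) :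
    s ≤ j ∧ j + 1 < s + T.numLeaves := by
  induction T generalizing s with
  | nil => exact h.elim
  | node _ l r hl hr =>
    have h1 := l.numLeaves_pos
    have h2 := r.numLeaves_pos
    simp only [BinaryTree.numLeaves]
    rcases h with ⟨-, -, h⟩ | h | h
    · omega
    · have := hl h; omega
    · have := hr h; omega

theorem deleteTerminal_eq_self {j : ℕ} {T : PlaneTree} {s : ℕ} (h : j ∉ terminalLabels T s) :
    deleteTerminal j T s = T := by
  induction T generalizing s with
  | nil => rfl
  | node _ l r hl hr =>
    simp only [terminalLabels, Set.mem_union, not_or] at h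
    rw [deleteTerminal, if_neg (show ¬(l = .nil ∧ r = .nil ∧ s = j) from h.1), hl h.2.1, hr h.2.2]

theorem numLeaves_deleteTerminal {j : ℕ} {T : PlaneTree} {s : ℕ} (h : j ∈ terminalLabels T s) :
    (deleteTerminal j T s).numLeaves + 1 = T.numLeaves := by
  induction T generalizing s with
  | nil => exact h.elim
  | node _ l r hl hr =>
    rw [deleteTerminal]
    by_cases hc : l = .nil ∧ r = .nil ∧ s = j
    · rw [if_pos hc, hc.1, hc.2.1]; rfl
    · rw [if_neg hc]
      simp only [BinaryTree.numLeaves]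
      rcases h with h | h | h
      · exact absurd h hc
      · have := terminalLabels_bounds h
        rw [deleteTerminal_eq_self (T := r) fun h' => by have := terminalLabels_bounds h'; omega,
          ← hl h]
        omega
      · have := terminalLabels_bounds h
        rw [deleteTerminal_eq_self (T := l) fun h' => by have := terminalLabels_bounds h'; omega,
          ← hr h]
        omega

theorem graft_elementary_deleteTerminal {j : ℕ} {T : PlaneTree} {s : ℕ}
    (h : j ∈ terminalLabels T s) :
    graft (IndexedForest.elementary j).tree (deleteTerminal j T s) s = T := by
  induction T generalizing s with
  | nil => exact h.elim
  | node _ l r hl hr =>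
    rw [deleteTerminal]
    by_cases hc : l = .nil ∧ r = .nil ∧ s = j
    · rw [if_pos hc, hc.1, hc.2.1, hc.2.2]
      simp [graft, IndexedForest.elementary]
    · rw [if_neg hc]
      simp only [graft]
      rcases h with h | h | h
      · exact absurd h hc
      · have h1 := terminalLabels_bounds h
        have h2 := numLeaves_deleteTerminal h
        rw [deleteTerminal_eq_self (T := r) fun h' => by have := terminalLabels_bounds h'; omega,
          hl h, graft_elementary_eq_self _ _ _ (by omega)]
      · have h1 := terminalLabels_bounds h
        rw [deleteTerminal_eq_self (T := l) fun h' => by have := terminalLabels_bounds h'; omega,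
          hr h, graft_elementary_eq_self _ _ _ (by omega)]

theorem mem_terminalLabels_graft_elementary {j : ℕ} {T : PlaneTree} {s : ℕ}
    (h1 : s ≤ j) (h2 : j < s + T.numLeaves) :
    j ∈ terminalLabels (graft (IndexedForest.elementary j).tree T s)
      (firstLeaf (IndexedForest.elementary j).tree s) := by
  induction T generalizing s with
  | nil =>
    have : s = j := by simp only [BinaryTree.numLeaves] at h2; omega
    subst this
    rw [firstLeaf_elementary, if_pos le_rfl]
    simp [graft, IndexedForest.elementary, terminalLabels]
  | node _ l r hl hr =>
    simp only [BinaryTree.numLeaves] at h2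
    simp only [graft, terminalLabels]
    right
    rw [firstLeaf_graft]
    by_cases h : j < s + l.numLeaves
    · exact Or.inl (hl h1 h)
    · exact Or.inr (hr (by omega) (by omega))

theorem deleteTerminal_graft_elementary (j : ℕ) (T : PlaneTree) (s : ℕ) :
    deleteTerminal j (graft (IndexedForest.elementary j).tree T s)
      (firstLeaf (IndexedForest.elementary j).tree s) = T := by
  induction T generalizing s with
  | nil =>
    by_cases h : s = j
    · subst h
      rw [firstLeaf_elementary, if_pos le_rfl]
      simp [graft, IndexedForest.elementary, deleteTerminal]
    · simp [graft, IndexedForest.elementary, h, deleteTerminal]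
  | node _ l r hl hr =>
    simp only [graft, deleteTerminal]
    rw [firstLeaf_graft, hl, hr, if_neg]
    -- The root cannot be the deleted node: its first leaf would have label `j`, but leaf `j` of `T`
    -- has just been replaced by an internal node.
    rintro ⟨h1, -, h3⟩
    rw [firstLeaf_elementary] at h3
    have hs : s = j := by split_ifs at h3 <;> omega
    cases l with
    | nil => simp [graft, IndexedForest.elementary, hs] at h1
    | node _ _ _ => simp [graft] at h1

theorem exists_firstLeaf_le_lt (G : ℕ → PlaneTree) (j : ℕ) :
    ∃ k, firstLeaf G k ≤ j ∧ j < firstLeaf G (k + 1) := by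
  have hex : ∃ k, j < firstLeaf G (k + 1) :=
    ⟨j, (Nat.lt_succ_self j).trans_le ((firstLeaf_strictMono G).le_apply)⟩
  classical
  refine ⟨Nat.find hex, ?_, Nat.find_spec hex⟩
  rcases h : Nat.find hex with _ | k
  · simp [firstLeaf]
  · exact not_lt.1 (Nat.find_min hex (m := k) (by omega))

/-! ### Factorizations in the forest monoid -/

namespace IndexedForest

theorem elementary_mul_elementary {i j : ℕ} (h : j < i) :
    elementary i * elementary j = elementary j * elementary (i + 1) := by
  ext1
  rw [elementary_mul, elementary_mul]
  funext k
  simp only [elementary]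
  split_ifs <;> first | rfl | omega

theorem elementary_mul_cancel {i : ℕ} {G H : IndexedForest}
    (h : elementary i * G = elementary i * H) : G = H := by
  have h' : (elementary i * G).tree = (elementary i * H).tree := by rw [h]
  rw [elementary_mul, elementary_mul] at h'
  ext1
  funext k
  have hi := congrFun h' i
  simp only [lt_irrefl, if_false, if_true, BinaryTree.node.injEq, true_and] at hi
  rcases lt_trichotomy k i with hk | rfl | hk
  · simpa [hk] using congrFun h' k
  · exact hi.1
  · obtain ⟨m, rfl⟩ := Nat.exists_eq_add_of_lt hk
    rcases m with _ | m
    · exact hi.2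
    · simpa [show ¬ i + (m + 1) < i by omega] using congrFun h' (i + (m + 1))

theorem elementary_mul_ne_one (i : ℕ) (G : IndexedForest) : elementary i * G ≠ 1 := fun h => by
  have h' : (elementary i * G).tree i = .nil := by rw [h, one_tree]
  rw [elementary_mul] at h'
  simp at h'

/-- Two different first letters always come from one commutation relation. Comparing the trees at
position `j` shows that `U` itself starts with `j`; cancellation then gives `V`. -/
theorem exists_of_elementary_mul_eq {i j : ℕ} (hij : j < i) {U V : IndexedForest}
    (h : elementary i * U = elementary j * V) :
    ∃ G, U = elementary j * G ∧ V = elementary (i + 1) * G := by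
  have hU : U.tree j = .node () (V.tree j) (V.tree (j + 1)) := by
    have h' : (elementary i * U).tree j = (elementary j * V).tree j := by rw [h]
    rw [elementary_mul, elementary_mul] at h'
    simpa [hij] using h'
  let G : IndexedForest :=
    { tree := fun k => if k < j then U.tree k else if k = j then V.tree j else
        if k = j + 1 then V.tree (j + 1) else U.tree (k - 1)
      finite := by
        refine ((U.finite.image (· + 1)).union (Set.finite_lt_nat (j + 2))).subset fun k hk => ?_
        by_cases hkj : k < j + 2
        · exact Or.inr hkj
        · refine Or.inl ⟨k - 1, ?_, by simp; omega⟩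
          have hk' : (if k < j then U.tree k else if k = j then V.tree j else
            if k = j + 1 then V.tree (j + 1) else U.tree (k - 1)) ≠ .nil := hk
          rw [if_neg (by omega), if_neg (by omega), if_neg (by omega)] at hk'
          exact hk' }
  have hUG : U = elementary j * G := by
    ext1
    rw [elementary_mul]
    funext k
    rcases lt_trichotomy k j with hk | rfl | hk
    · simp [hk, G]
    · simp [hU, G]
    · simp [hk.not_gt, hk.ne', G, show ¬ k + 1 < j by omega, show k + 1 ≠ j by omega]
  refine ⟨G, hUG, elementary_mul_cancel (i := j) ?_⟩
  rw [← h, hUG, ← mul_assoc, elementary_mul_elementary hij, mul_assoc]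

/-- Two factorizations of the same forest are related by the moves `i · j ↔ j · (i + 1)`, `j < i`. -/
theorem word_induction {r : List ℕ → List ℕ → Prop} (refl : ∀ w, r w w)
    (symm : ∀ v w, r v w → r w v) (trans : ∀ u v w, r u v → r v w → r u w)
    (cons : ∀ i v w, r v w → r (i :: v) (i :: w))
    (swap : ∀ i j w, j < i → r (i :: j :: w) (j :: (i + 1) :: w)) {v w : List ℕ}
    (h : (v.map elementary).prod = (w.map elementary).prod) : r v w := by
  -- Equality of lengths is proved along with `r`, because the induction on length must also be
  -- applied to auxiliary words through the common factor.
  suffices main : ∀ (n : ℕ) (v w : List ℕ), v.length = n →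
      (v.map elementary).prod = (w.map elementary).prod → r v w ∧ v.length = w.length from
    (main _ v w rfl h).1
  intro n
  induction n with
  | zero =>
    intro v w hv h
    rw [List.length_eq_zero_iff.1 hv] at h ⊢
    cases w with
    | nil => exact ⟨refl _, rfl⟩
    | cons i w =>
      simp only [List.map_nil, List.prod_nil, List.map_cons, List.prod_cons] at h
      exact absurd h.symm (elementary_mul_ne_one _ _)
  | succ n ih =>
    -- The disjunction lets this serve both orders of the first letters: only one of the two tails
    -- is known in advance to have length `n`.
    have aux : ∀ (i j : ℕ) (v w : List ℕ), j < i → v.length = n ∨ w.length = n →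
        ((i :: v).map elementary).prod = ((j :: w).map elementary).prod →
        r (i :: v) (j :: w) ∧ v.length = w.length := by
      intro i j v w hij hl h
      simp only [List.map_cons, List.prod_cons] at h
      obtain ⟨G, hv, hw⟩ := exists_of_elementary_mul_eq hij h
      obtain ⟨g, hg⟩ := G.trimmingWords_nonempty
      have hg' : (g.map elementary).prod = G := hg
      have hv' : (v.map elementary).prod = ((j :: g).map elementary).prod := by simp [hv, hg']
      have hw' : (w.map elementary).prod = (((i + 1) :: g).map elementary).prod := by
        simp [hw, hg']
      have key : r v (j :: g) ∧ r ((i + 1) :: g) w ∧ v.length = w.length := by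
        rcases hl with hl | hl
        · obtain ⟨h1, h2⟩ := ih v _ hl hv'
          obtain ⟨h3, h4⟩ := ih ((i + 1) :: g) w (by simp at h2; simp [← hl, h2]) hw'.symm
          exact ⟨h1, h3, by simp at h2 h4; omega⟩
        · obtain ⟨h1, h2⟩ := ih w _ hl hw'
          obtain ⟨h3, h4⟩ := ih (j :: g) v (by simp at h2; simp [← hl, h2]) hv'.symm
          exact ⟨symm _ _ h3, symm _ _ h1, by simp at h2 h4; omega⟩
      exact ⟨trans _ _ _ (cons i _ _ key.1) (trans _ _ _ (swap i j g hij) (cons j _ _ key.2.1)),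
        key.2.2⟩
    intro v w hv h
    match v, w, hv with
    | i :: v, [], _ =>
      simp only [List.map_nil, List.prod_nil, List.map_cons, List.prod_cons] at h
      exact absurd h (elementary_mul_ne_one _ _)
    | i :: v, j :: w, hv =>
      simp only [List.length_cons, Nat.add_right_cancel_iff] at hv ⊢
      rcases lt_trichotomy i j with hij | rfl | hij
      · have := aux j i w v hij (Or.inr hv) h.symm
        exact ⟨symm _ _ this.1, this.2.symm⟩
      · simp only [List.map_cons, List.prod_cons] at h
        have := ih v w hv (elementary_mul_cancel h)
        exact ⟨cons _ _ _ this.1, this.2⟩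
      · exact aux i j v w hij (Or.inl hv) h

theorem length_eq_of_prod_eq {v w : List ℕ}
    (h : (v.map elementary).prod = (w.map elementary).prod) : v.length = w.length :=
  word_induction (r := fun v w => v.length = w.length) (fun _ => rfl) (fun _ _ => Eq.symm)
    (fun _ _ _ => Eq.trans) (fun _ _ _ h => by simp [h]) (fun _ _ _ _ => by simp) h

theorem mem_qDes_mul_elementary (G : IndexedForest) (j : ℕ) : j ∈ (G * elementary j).qDes := by
  obtain ⟨k, h1, h2⟩ := exists_firstLeaf_le_lt G.tree j
  refine ⟨k, ?_⟩
  rw [firstLeaf_mul]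
  exact mem_terminalLabels_graft_elementary h1 (by rwa [← firstLeaf_succ])

theorem trim_mul_elementary (G : IndexedForest) (j : ℕ) : (G * elementary j).trim j = G := by
  ext1
  funext k
  change deleteTerminal j ((G * elementary j).tree k) (firstLeaf (G * elementary j).tree k) = _
  rw [firstLeaf_mul]
  exact deleteTerminal_graft_elementary _ _ _

/-- The trees occupy disjoint intervals of leaf labels, so only tree `k` changes. Trimming removes
one leaf, which shifts the labels of all later trees down by one. -/
theorem trim_mul_elementary_of_mem_qDes {F : IndexedForest} {j : ℕ} (h : j ∈ F.qDes) :
    F.trim j * elementary j = F := by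
  obtain ⟨k, hk⟩ := h
  have hb := terminalLabels_bounds hk
  rw [add_comm (firstLeaf F.tree k), add_comm, add_comm (F.tree k).numLeaves,
    ← firstLeaf_succ] at hb
  have hne : ∀ m, m ≠ k → j ∉ terminalLabels (F.tree m) (firstLeaf F.tree m) := by
    intro m hm h'
    have hb' := terminalLabels_bounds h'
    rw [← firstLeaf_succ] at hb'
    rcases lt_or_gt_of_ne hm with h1 | h1
    · have := (firstLeaf_strictMono F.tree).monotone (Nat.succ_le_of_lt h1)
      simp only [Nat.succ_eq_add_one] at this
      omega
    · have := (firstLeaf_strictMono F.tree).monotone (Nat.succ_le_of_lt h1)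
      simp only [Nat.succ_eq_add_one] at this
      omega
  have hle : ∀ m ≤ k, firstLeaf (F.trim j).tree m = firstLeaf F.tree m := by
    intro m hm
    refine Finset.sum_congr rfl fun a ha => ?_
    rw [Finset.mem_range] at ha
    exact congrArg _ (deleteTerminal_eq_self (hne a (by omega)))
  have hgt : ∀ m, k < m → firstLeaf (F.trim j).tree m + 1 = firstLeaf F.tree m := by
    intro m hm
    induction m, hm using Nat.le_induction with
    | base =>
      rw [firstLeaf_succ, firstLeaf_succ, hle k le_rfl, ← numLeaves_deleteTerminal hk]
      rfl
    | succ m hm ih =>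
      rw [firstLeaf_succ, firstLeaf_succ, ← ih,
        show (F.trim j).tree m = F.tree m from deleteTerminal_eq_self (hne m (by omega))]
      omega
  ext1
  funext m
  rw [mul_tree]
  dsimp only
  rcases lt_trichotomy m k with hm | rfl | hm
  · rw [show (F.trim j).tree m = F.tree m from deleteTerminal_eq_self (hne m (by omega)),
      hle m hm.le]
    apply graft_elementary_eq_self
    have := (firstLeaf_strictMono F.tree).monotone (Nat.succ_le_of_lt hm)
    simp only [Nat.succ_eq_add_one, firstLeaf_succ F.tree m] at this
    omega
  · rw [hle m le_rfl]
    exact graft_elementary_deleteTerminal hk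
  · rw [show (F.trim j).tree m = F.tree m from deleteTerminal_eq_self (hne m (by omega))]
    apply graft_elementary_eq_self
    have h1 := hgt m hm
    have := (firstLeaf_strictMono F.tree).monotone (Nat.succ_le_of_lt hm)
    simp only [Nat.succ_eq_add_one] at this
    omega

theorem mul_elementary_eq_iff {F G : IndexedForest} {j : ℕ} :
    G * elementary j = F ↔ j ∈ F.qDes ∧ G = F.trim j := by
  constructor
  · rintro rfl
    exact ⟨mem_qDes_mul_elementary G j, (trim_mul_elementary G j).symm⟩
  · rintro ⟨h, rfl⟩
    exact trim_mul_elementary_of_mem_qDes h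

theorem exists_qDes_lt (F : IndexedForest) : ∃ n, ∀ j ∈ F.qDes, j < n := by
  obtain ⟨N, hN⟩ := F.finite.bddAbove
  refine ⟨firstLeaf F.tree (N + 1), ?_⟩
  rintro j ⟨k, hk⟩
  have hkN : k ≤ N := hN fun h0 => by simp [h0, terminalLabels] at hk
  have hb := terminalLabels_bounds hk
  rw [← firstLeaf_succ] at hb
  have := (firstLeaf_strictMono F.tree).monotone (Nat.succ_le_succ hkN)
  simp only [Nat.succ_eq_add_one] at this
  omega

end IndexedForest

/-! ### Complements of finite sets and the product `⋆` -/

open MvPolynomial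

theorem infinite_compl (A : Finset ℕ) : (Set.ofPred fun n => n ∉ A).Infinite :=
  A.finite_toSet.infinite_compl

theorem complNth_strictMono (A : Finset ℕ) : StrictMono (complNth A) :=
  Nat.nth_strictMono (infinite_compl A)

theorem range_complNth (A : Finset ℕ) : Set.range (complNth A) = {n | n ∉ A} :=
  Nat.range_nth_of_infinite (infinite_compl A)

theorem complNth_eq_of_range {A : Finset ℕ} {φ : ℕ → ℕ} (h : StrictMono φ)
    (hr : Set.range φ = {n | n ∉ A}) : complNth A = φ :=
  ((complNth_strictMono A).range_inj h).1 ((range_complNth A).trans hr.symm)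

@[simp]
theorem complNth_empty : complNth ∅ = id :=
  complNth_eq_of_range strictMono_id (by simp)

theorem complNth_singleton (i : ℕ) : complNth {i} = fun k => if k < i then k else k + 1 := by
  apply complNth_eq_of_range
  · intro a b hab
    dsimp only
    split_ifs <;> omega
  · ext n
    simp only [Set.mem_range, Finset.mem_singleton, Set.mem_ofPred_eq]
    constructor
    · rintro ⟨k, rfl⟩
      split_ifs <;> omega
    · intro h
      rcases lt_or_gt_of_ne h with h | h
      · exact ⟨n, if_pos h⟩
      · exact ⟨n - 1, by rw [if_neg (by omega)]; omega⟩

/-- This turns `⋆` into composition of increasing enumerations, so identities between sets become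
identities between explicit maps. -/
theorem complNth_starSet (B A : Finset ℕ) :
    complNth (starSet B A) = complNth A ∘ complNth B := by
  apply complNth_eq_of_range ((complNth_strictMono A).comp (complNth_strictMono B))
  rw [Set.range_comp, range_complNth]
  ext n
  simp only [starSet, Set.mem_image, Set.mem_ofPred_eq, Finset.mem_union, Finset.mem_image, not_or,
    not_exists, not_and]
  constructor
  · rintro ⟨k, hk, rfl⟩
    refine ⟨fun m hm h => hk ((complNth_strictMono A).injective h ▸ hm), ?_⟩
    have : complNth A k ∈ {n | n ∉ A} := range_complNth A ▸ Set.mem_range_self k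
    exact this
  · rintro ⟨h1, h2⟩
    have h2' : n ∈ Set.range (complNth A) := by rw [range_complNth]; exact h2
    obtain ⟨k, rfl⟩ := h2'
    exact ⟨k, fun hk => h1 k hk rfl, rfl⟩

theorem eq_of_complNth_eq {A B : Finset ℕ} (h : complNth A = complNth B) : A = B := by
  have h' := range_complNth A
  rw [h, range_complNth] at h'
  ext n
  have := Set.ext_iff.1 h' n
  simp only [Set.mem_ofPred_eq] at this
  tauto

@[simp]
theorem starSet_empty (B : Finset ℕ) : starSet B ∅ = B :=
  eq_of_complNth_eq (by rw [complNth_starSet]; simp)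

theorem starSet_comm {i j : ℕ} (h : j < i) (A : Finset ℕ) :
    starSet {i} (starSet {j} A) = starSet {j} (starSet {i + 1} A) := by
  apply eq_of_complNth_eq
  simp only [complNth_starSet, complNth_singleton, Function.comp_assoc]
  congr 1
  funext k
  simp only [Function.comp_apply]
  split_ifs <;> omega

theorem tHat_starSet_of_lt {i j : ℕ} (h : i < j) (A : Finset ℕ) :
    tHat (starSet {j} A) i = tHat A i := by
  simp [tHat, complNth_starSet, complNth_singleton, h]

theorem tHat_starSet_of_le {i j : ℕ} (h : j ≤ i) (A : Finset ℕ) :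
    tHat (starSet {j} A) i = tHat A (i + 1) := by
  simp [tHat, complNth_starSet, complNth_singleton, h.not_gt]

/-! ### Trimming operators and their commutation -/

theorem X_sub_C_ne_zero (i : ℕ) (a : CoeffRing) : (X i - C a : PolyRing) ≠ 0 := fun h => by
  have := congrArg (aeval fun _ => a + 1 : PolyRing →ₐ[CoeffRing] CoeffRing) h
  simp at this

/-- The quotient is unique in a domain; this replaces the choice in the definition of `trimOp`. -/
theorem trimOp_eq_of_mul_eq {i : ℕ} {A : Finset ℕ} {f g : PolyRing}
    (h : (X i - C (tHat A i)) * g = rPlus i A f - rMinus i A f) : trimOp i A f = g :=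
  mul_left_cancel₀ (X_sub_C_ne_zero i _) ((mul_trimOp i A f).trans h.symm)

theorem trimOp_add (i : ℕ) (A : Finset ℕ) (f g : PolyRing) :
    trimOp i A (f + g) = trimOp i A f + trimOp i A g :=
  trimOp_eq_of_mul_eq (by rw [mul_add, mul_trimOp, mul_trimOp, map_add, map_add]; ring)

theorem trimOp_smul (i : ℕ) (A : Finset ℕ) (a : CoeffRing) (f : PolyRing) :
    trimOp i A (a • f) = a • trimOp i A f :=
  trimOp_eq_of_mul_eq (by rw [mul_smul_comm, mul_trimOp, map_smul, map_smul, smul_sub])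

/-- The trimming operation as a linear map. -/
noncomputable def trimLin (i : ℕ) (A : Finset ℕ) : PolyRing →ₗ[CoeffRing] PolyRing where
  toFun := trimOp i A
  map_add' := trimOp_add i A
  map_smul' := trimOp_smul i A

@[simp]
theorem trimOp_zero (i : ℕ) (A : Finset ℕ) : trimOp i A 0 = 0 := map_zero (trimLin i A)

theorem trimOp_sub (i : ℕ) (A : Finset ℕ) (f g : PolyRing) :
    trimOp i A (f - g) = trimOp i A f - trimOp i A g := map_sub (trimLin i A) f g

@[simp]
theorem trimOp_C (i : ℕ) (A : Finset ℕ) (a : CoeffRing) : trimOp i A (C a) = 0 :=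
  trimOp_eq_of_mul_eq (by simp [rPlus, rMinus])

@[simp]
theorem rPlus_C (i : ℕ) (A : Finset ℕ) (a : CoeffRing) : rPlus i A (C a) = C a := algHom_C _ a

@[simp]
theorem rMinus_C (i : ℕ) (A : Finset ℕ) (a : CoeffRing) : rMinus i A (C a) = C a := algHom_C _ a

theorem rPlus_X (i : ℕ) (A : Finset ℕ) (k : ℕ) : rPlus i A (X k) =
    if k < i + 1 then X k else if k = i + 1 then C (tHat A i) else X (k - 1) := aeval_X _ k

theorem rMinus_X (i : ℕ) (A : Finset ℕ) (k : ℕ) : rMinus i A (X k) =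
    if k < i then X k else if k = i then C (tHat A i) else X (k - 1) := aeval_X _ k

/-- The four composites of `R⁺` and `R⁻` on one side match those on the other, since both insert the
same two values at the same places. After clearing the denominators `x_j - t_{j,A}` and `x_i -
t_{i+1,A}`, both sides are the same alternating sum. -/
theorem trimOp_comm {i j : ℕ} (h : j < i) (A : Finset ℕ) (f : PolyRing) :
    trimOp i (starSet {j} A) (trimOp j A f) =
      trimOp j (starSet {i + 1} A) (trimOp (i + 1) A f) := by
  have h' : j < i + 1 := by omega
  have hpp : (rPlus i (starSet {j} A)).comp (rPlus j A) =
      (rPlus j (starSet {i + 1} A)).comp (rPlus (i + 1) A) := by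
    refine MvPolynomial.algHom_ext fun k => ?_
    simp only [AlgHom.comp_apply, rPlus_X]
    split_ifs <;> simp only [rPlus_X, rPlus_C, tHat_starSet_of_lt h',
      tHat_starSet_of_le h.le] <;> (try split_ifs) <;> first | rfl | omega
  have hpm : (rPlus i (starSet {j} A)).comp (rMinus j A) =
      (rMinus j (starSet {i + 1} A)).comp (rPlus (i + 1) A) := by
    refine MvPolynomial.algHom_ext fun k => ?_
    simp only [AlgHom.comp_apply, rPlus_X, rMinus_X]
    split_ifs <;> simp only [rPlus_X, rMinus_X, rPlus_C, rMinus_C, tHat_starSet_of_lt h',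
      tHat_starSet_of_le h.le] <;> (try split_ifs) <;> first | rfl | omega
  have hmp : (rMinus i (starSet {j} A)).comp (rPlus j A) =
      (rPlus j (starSet {i + 1} A)).comp (rMinus (i + 1) A) := by
    refine MvPolynomial.algHom_ext fun k => ?_
    simp only [AlgHom.comp_apply, rPlus_X, rMinus_X]
    split_ifs <;> simp only [rPlus_X, rMinus_X, rPlus_C, rMinus_C, tHat_starSet_of_lt h',
      tHat_starSet_of_le h.le] <;> (try split_ifs) <;> first | rfl | omega
  have hmm : (rMinus i (starSet {j} A)).comp (rMinus j A) =
      (rMinus j (starSet {i + 1} A)).comp (rMinus (i + 1) A) := by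
    refine MvPolynomial.algHom_ext fun k => ?_
    simp only [AlgHom.comp_apply, rMinus_X]
    split_ifs <;> simp only [rMinus_X, rMinus_C, tHat_starSet_of_lt h',
      tHat_starSet_of_le h.le] <;> (try split_ifs) <;> first | rfl | omega
  have hpp' := DFunLike.congr_fun hpp f
  have hpm' := DFunLike.congr_fun hpm f
  have hmp' := DFunLike.congr_fun hmp f
  have hmm' := DFunLike.congr_fun hmm f
  simp only [AlgHom.comp_apply] at hpp' hpm' hmp' hmm'
  have hj := mul_trimOp j A f
  have hi := mul_trimOp (i + 1) A f
  have h1 := mul_trimOp i (starSet {j} A) (trimOp j A f)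
  have h2 := mul_trimOp j (starSet {i + 1} A) (trimOp (i + 1) A f)
  have hjp := congrArg (rPlus i (starSet {j} A)) hj
  have hjm := congrArg (rMinus i (starSet {j} A)) hj
  have hip := congrArg (rPlus j (starSet {i + 1} A)) hi
  have him := congrArg (rMinus j (starSet {i + 1} A)) hi
  rw [map_mul, map_sub, map_sub, hpp', hpm'] at hjp
  rw [map_mul, map_sub, map_sub, hmp', hmm'] at hjm
  rw [map_mul, map_sub, map_sub] at hip him
  have e1 : rPlus i (starSet {j} A) (X j) = X j := by rw [rPlus_X, if_pos h']
  have e2 : rMinus i (starSet {j} A) (X j) = X j := by rw [rMinus_X, if_pos h]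
  have e3 : rPlus j (starSet {i + 1} A) (X (i + 1)) = X i := by
    rw [rPlus_X, if_neg (by omega), if_neg (by omega), Nat.add_sub_cancel]
  have e4 : rMinus j (starSet {i + 1} A) (X (i + 1)) = X i := by
    rw [rMinus_X, if_neg (by omega), if_neg (by omega), Nat.add_sub_cancel]
  rw [e1, rPlus_C] at hjp
  rw [e2, rMinus_C] at hjm
  rw [e3, rPlus_C] at hip
  rw [e4, rMinus_C] at him
  rw [tHat_starSet_of_le h.le] at h1
  rw [tHat_starSet_of_lt (by omega)] at h2
  apply mul_left_cancel₀ (X_sub_C_ne_zero i (tHat A (i + 1)))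
  apply mul_left_cancel₀ (X_sub_C_ne_zero j (tHat A j))
  linear_combination (X j - C (tHat A j)) * h1 - (X i - C (tHat A (i + 1))) * h2 + hjp - hjm
    - hip + him

/-! ### ⋆-compositions and their independence of the factorization -/

theorem starWeight_append (v w : List ℕ) (A : Finset ℕ) :
    starWeight (v ++ w) A = starWeight v (starWeight w A) := List.foldr_append

theorem starComp_append (v w : List ℕ) (A : Finset ℕ) (f : PolyRing) :
    starComp A (v ++ w) f = starComp (starWeight w A) v (starComp A w f) := by
  induction v with
  | nil => rfl
  | cons i v ih =>
    simp only [List.cons_append, starComp]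
    rw [starWeight_append, ih]

/-- The last letter acts first and changes the base set. Inductions on words peel it off, and
therefore need a general `A`. -/
theorem evStar_append_singleton (w : List ℕ) (i : ℕ) (A : Finset ℕ) (f : PolyRing) :
    evStar A (w ++ [i]) f = evStar (starSet {i} A) w (trimOp i A f) := by
  unfold evStar
  rw [starWeight_append, starComp_append]
  rfl

/-- The operation `[ev ⋆ E_{i₁} ⋆ ⋯ ⋆ E_{i_k}]_A` as a linear map. -/
noncomputable def evStarLin (A : Finset ℕ) (w : List ℕ) : PolyRing →ₗ[CoeffRing] CoeffRing where
  toFun := evStar A w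
  map_add' f g := by
    induction w using List.reverseRecOn generalizing A f g with
    | nil => exact map_add (evA A) f g
    | append_singleton w i ih => simp only [evStar_append_singleton, trimOp_add, ih]
  map_smul' a f := by
    induction w using List.reverseRecOn generalizing A f with
    | nil => exact map_smul (evA A) a f
    | append_singleton w i ih => simp only [evStar_append_singleton, trimOp_smul, ih]

theorem evStarLin_apply (A : Finset ℕ) (w : List ℕ) (f : PolyRing) :
    evStarLin A w f = evStar A w f := rfl

@[simp]
theorem evStar_zero (A : Finset ℕ) (w : List ℕ) : evStar A w 0 = 0 := map_zero (evStarLin A w)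

theorem evStar_sub (A : Finset ℕ) (w : List ℕ) (f g : PolyRing) :
    evStar A w (f - g) = evStar A w f - evStar A w g := map_sub (evStarLin A w) f g

theorem evStar_eq_of_prod_eq (A : Finset ℕ) (f : PolyRing) {v w : List ℕ}
    (h : (v.map IndexedForest.elementary).prod = (w.map IndexedForest.elementary).prod) :
    evStar A v f = evStar A w f := by
  -- The weights must be carried along: they index the operator contributed by the next letter on
  -- the left.
  have key : starWeight v A = starWeight w A ∧ starComp A v f = starComp A w f := by
    refine IndexedForest.word_induction
      (r := fun v w => starWeight v A = starWeight w A ∧ starComp A v f = starComp A w f)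
      (fun _ => ⟨rfl, rfl⟩) (fun _ _ h => ⟨h.1.symm, h.2.symm⟩)
      (fun _ _ _ h1 h2 => ⟨h1.1.trans h2.1, h1.2.trans h2.2⟩) (fun i v w h => ?_)
      (fun i j w hij => ?_) h
    · refine ⟨?_, ?_⟩
      · change starSet {i} (starWeight v A) = starSet {i} (starWeight w A)
        rw [h.1]
      · simp only [starComp, h.1, h.2]
    · exact ⟨starSet_comm hij _, trimOp_comm hij _ _⟩
  rw [evStar, evStar, key.1, key.2]

/-! ### Trimming and the variables that occur -/

theorem rPlus_eq_self {i n : ℕ} (h : n ≤ i + 1) (A : Finset ℕ) {f : PolyRing}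
    (hf : f ∈ supported CoeffRing (Set.Iio n)) : rPlus i A f = f := by
  refine AlgHom.adjoin_le_equalizer (rPlus i A) (AlgHom.id CoeffRing PolyRing) ?_ hf
  rintro _ ⟨k, hk, rfl⟩
  have : k < i + 1 := lt_of_lt_of_le hk h
  simp [rPlus_X, this]

theorem rMinus_eq_self {i n : ℕ} (h : n ≤ i) (A : Finset ℕ) {f : PolyRing}
    (hf : f ∈ supported CoeffRing (Set.Iio n)) : rMinus i A f = f := by
  refine AlgHom.adjoin_le_equalizer (rMinus i A) (AlgHom.id CoeffRing PolyRing) ?_ hf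
  rintro _ ⟨k, hk, rfl⟩
  have : k < i := lt_of_lt_of_le hk h
  simp [rMinus_X, this]

theorem rMinus_mem_supported {i : ℕ} (A : Finset ℕ) {f : PolyRing}
    (hf : f ∈ supported CoeffRing (Set.Iio (i + 1))) :
    rMinus i A f ∈ supported CoeffRing (Set.Iio i) := by
  have : supported CoeffRing (Set.Iio (i + 1)) ≤
      (supported CoeffRing (Set.Iio i)).comap (rMinus i A) := by
    refine Algebra.adjoin_le ?_
    rintro _ ⟨k, hk, rfl⟩
    change rMinus i A (X k) ∈ supported CoeffRing (Set.Iio i)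
    have hk' : k < i + 1 := hk
    simp only [rMinus, aeval_X]
    split_ifs with h1 h2
    · exact (X_mem_supported).2 h1
    · exact Subalgebra.algebraMap_mem _ _
    · omega
  exact this hf

theorem trimOp_eq_zero_of_mem_supported {i n : ℕ} (h : n ≤ i) (A : Finset ℕ) {f : PolyRing}
    (hf : f ∈ supported CoeffRing (Set.Iio n)) : trimOp i A f = 0 :=
  trimOp_eq_of_mul_eq (by
    rw [rPlus_eq_self (by omega) A hf, rMinus_eq_self h A hf, sub_self, mul_zero])

theorem exists_mem_supported (f : PolyRing) : ∃ n, f ∈ supported CoeffRing (Set.Iio n) := by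
  obtain ⟨n, hn⟩ := f.vars.bddAbove
  refine ⟨n + 1, mem_supported.2 fun k hk => ?_⟩
  exact Nat.lt_succ_of_le (hn hk)

/-- If `x_m` is the last variable allowed, `R⁺_m` fixes `f`; so `E_m f = 0` gives `f = R⁻_m f`,
which is free of `x_m`. Descend to `n`. -/
theorem mem_supported_of_trimOp_eq_zero (n : ℕ) (A : Finset ℕ) (f : PolyRing)
    (h : ∀ i, n ≤ i → trimOp i A f = 0) : f ∈ supported CoeffRing (Set.Iio n) := by
  obtain ⟨m, hm⟩ := exists_mem_supported f
  induction m with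
  | zero => exact supported_mono (Set.Iio_subset_Iio (Nat.zero_le n)) hm
  | succ m ih =>
    rcases Nat.lt_or_ge m n with hmn | hmn
    · exact supported_mono (Set.Iio_subset_Iio hmn) hm
    · apply ih
      have h1 := mul_trimOp m A f
      rw [h m hmn, mul_zero, rPlus_eq_self le_rfl A hm] at h1
      rw [sub_eq_zero.1 h1.symm]
      exact rMinus_mem_supported A hm

theorem trimOp_mem_supported {i n : ℕ} (A : Finset ℕ) {f : PolyRing}
    (hf : f ∈ supported CoeffRing (Set.Iio n)) :
    trimOp i A f ∈ supported CoeffRing (Set.Iio n) := by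
  rcases Nat.lt_or_ge i n with h | h
  -- For `k ≥ n`, commutation turns `E_k E_i f` into `E_i E_{k+1} f`, which vanishes.
  · refine mem_supported_of_trimOp_eq_zero n (starSet {i} A) _ fun k hk => ?_
    rw [trimOp_comm (h.trans_le hk), trimOp_eq_zero_of_mem_supported (by omega) A hf, trimOp_zero]
  · rw [trimOp_eq_zero_of_mem_supported h A hf]
    exact zero_mem _

/-- An explicit antiderivative: `R⁺_n` fixes the product, and `R⁻_n` kills its first factor. -/
theorem trimOp_mul_of_mem_supported {n : ℕ} (A : Finset ℕ) {g : PolyRing}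
    (hg : g ∈ supported CoeffRing (Set.Iio (n + 1))) :
    trimOp n A ((X n - C (tHat A n)) * g) = g := by
  apply trimOp_eq_of_mul_eq
  rw [map_mul, map_mul, rPlus_eq_self le_rfl A hg]
  simp [rPlus, rMinus]

theorem eq_zero_of_trimOp_eq_zero {A : Finset ℕ} {f : PolyRing} (h : ∀ i, trimOp i A f = 0)
    (h0 : evA A f = 0) : f = 0 := by
  have := mem_supported_of_trimOp_eq_zero 0 A f fun i _ => h i
  rw [show (Set.Iio 0 : Set ℕ) = ∅ by ext; simp, supported_empty, Algebra.mem_bot] at this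
  obtain ⟨a, rfl⟩ := this
  rw [AlgHom.commutes] at h0
  rw [show a = 0 from h0, map_zero]

theorem evStar_eq_zero_of_mem_supported {n : ℕ} {A : Finset ℕ} {w : List ℕ} {f : PolyRing}
    (hf : f ∈ supported CoeffRing (Set.Iio n)) (hw : ∃ i ∈ w, n ≤ i) : evStar A w f = 0 := by
  induction w using List.reverseRecOn generalizing A f with
  | nil => simp at hw
  | append_singleton w i ih =>
    rw [evStar_append_singleton]
    by_cases hi : n ≤ i
    · rw [trimOp_eq_zero_of_mem_supported hi A hf, evStar_zero]
    · obtain ⟨k, hk, hnk⟩ := hw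
      rw [List.mem_append, List.mem_singleton] at hk
      refine ih (trimOp_mem_supported A hf) ⟨k, hk.resolve_right ?_, hnk⟩
      rintro rfl
      exact hi hnk

/-! ### Reindexing the variables `t` -/

theorem substT_X (A : Finset ℕ) (k : ℕ) : substT A (X k) = X k := map_X _ _

theorem substT_C (A : Finset ℕ) (a : CoeffRing) :
    substT A (C a) = C (rename (complNth A) a) := map_C _ _

theorem rename_tHat (A : Finset ℕ) (B : Finset ℕ) (i : ℕ) :
    rename (complNth A) (tHat B i) = tHat (starSet B A) i := by
  simp [tHat, complNth_starSet]

theorem substT_rPlus (A B : Finset ℕ) (i : ℕ) (f : PolyRing) :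
    substT A (rPlus i B f) = rPlus i (starSet B A) (substT A f) := by
  refine RingHom.congr_fun (f := (substT A).comp (rPlus i B : PolyRing →+* PolyRing))
    (g := (rPlus i (starSet B A) : PolyRing →+* PolyRing).comp (substT A)) ?_ f
  refine MvPolynomial.ringHom_ext (fun a => ?_) fun k => ?_
  · simp [substT_C, rPlus]
  · simp only [RingHom.comp_apply, substT_X, RingHom.coe_coe, rPlus, aeval_X]
    split_ifs <;> simp [substT_X, substT_C, rename_tHat]

theorem substT_rMinus (A B : Finset ℕ) (i : ℕ) (f : PolyRing) :
    substT A (rMinus i B f) = rMinus i (starSet B A) (substT A f) := by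
  refine RingHom.congr_fun (f := (substT A).comp (rMinus i B : PolyRing →+* PolyRing))
    (g := (rMinus i (starSet B A) : PolyRing →+* PolyRing).comp (substT A)) ?_ f
  refine MvPolynomial.ringHom_ext (fun a => ?_) fun k => ?_
  · simp [substT_C, rMinus]
  · simp only [RingHom.comp_apply, substT_X, RingHom.coe_coe, rMinus, aeval_X]
    split_ifs <;> simp [substT_X, substT_C, rename_tHat]

theorem evA_substT (A B : Finset ℕ) (f : PolyRing) :
    evA (starSet B A) (substT A f) = rename (complNth A) (evA B f) := by
  refine RingHom.congr_fun
    (f := (evA (starSet B A) : PolyRing →+* CoeffRing).comp (substT A))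
    (g := (rename (complNth A) : CoeffRing →ₐ[ℤ] CoeffRing).toRingHom.comp
      (evA B : PolyRing →+* CoeffRing)) ?_ f
  refine MvPolynomial.ringHom_ext (fun a => ?_) fun k => ?_
  · simp [substT_C, evA]
  · simp [substT_X, evA, rename_tHat]

theorem trimOp_substT (A B : Finset ℕ) (i : ℕ) (f : PolyRing) :
    trimOp i (starSet B A) (substT A f) = substT A (trimOp i B f) := by
  apply trimOp_eq_of_mul_eq
  rw [← substT_rPlus, ← substT_rMinus, ← map_sub, ← mul_trimOp, map_mul, map_sub, substT_X,
    substT_C, rename_tHat]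

theorem starSet_assoc (A B D : Finset ℕ) : starSet D (starSet B A) = starSet (starSet D B) A :=
  eq_of_complNth_eq (by simp only [complNth_starSet, Function.comp_assoc])

/-- Reindexing by `A` sends `t_{i,B}` to `t_{i,B⋆A}`, hence intertwines trimming and evaluation at
`B` with those at `B ⋆ A`. This absorbs the twist by `t̂_i` in the recursion. -/
theorem evStar_substT (A B : Finset ℕ) (w : List ℕ) (f : PolyRing) :
    evStar (starSet B A) w (substT A f) = rename (complNth A) (evStar B w f) := by
  induction w using List.reverseRecOn generalizing B f with
  | nil => exact evA_substT A B f
  | append_singleton w i ih =>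
    rw [evStar_append_singleton, evStar_append_singleton, trimOp_substT, starSet_assoc, ih]

theorem evStar_empty_substT (A : Finset ℕ) (w : List ℕ) (f : PolyRing) :
    evStar A w (substT A f) = rename (complNth A) (evStar ∅ w f) := by
  have h : starSet ∅ A = A := eq_of_complNth_eq (by rw [complNth_starSet]; simp)
  rw [← evStar_substT, h]


/-! ### Joint homogeneity -/

theorem isHomogeneous_of_mul {σ R : Type*} [CommRing R] [IsDomain R] {p q : MvPolynomial σ R}
    {m n : ℕ} (hp : p.IsHomogeneous m) (hp0 : p ≠ 0) (h : (p * q).IsHomogeneous (m + n)) :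
    q.IsHomogeneous n := by
  have hcomp : ∀ k, homogeneousComponent (m + k) (p * q) = p * homogeneousComponent k q := by
    intro k
    conv_lhs => rw [← sum_homogeneousComponent q, Finset.mul_sum, map_sum]
    rw [Finset.sum_congr rfl fun j _ => homogeneousComponent_of_mem
      (hp.mul (homogeneousComponent_isHomogeneous j q))]
    simp only [Nat.add_left_cancel_iff, Finset.sum_ite_eq, Finset.mem_range]
    split_ifs with hk
    · rfl
    · rw [homogeneousComponent_eq_zero k q (by omega), mul_zero]
  have hz : ∀ k, k ≠ n → homogeneousComponent k q = 0 := by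
    intro k hk
    have := hcomp k
    rw [homogeneousComponent_of_mem h, if_neg (by omega)] at this
    exact (mul_eq_zero.1 this.symm).resolve_left hp0
  rw [← sum_homogeneousComponent q]
  refine IsHomogeneous.sum _ _ _ fun k _ => ?_
  by_cases hk : k = n
  · exact hk ▸ homogeneousComponent_isHomogeneous k q
  · rw [hz k hk]
    exact isHomogeneous_zero _ _ _

/-- Homogeneity of degree `d`, jointly in the variables `x` and `t`. -/
def IsJointlyHomogeneous (d : ℕ) (f : PolyRing) : Prop :=
  ((sumAlgEquiv ℤ ℕ ℕ).symm f).IsHomogeneous d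

namespace IsJointlyHomogeneous

variable {d e : ℕ} {f g : PolyRing}

theorem zero (d : ℕ) : IsJointlyHomogeneous d 0 := by
  simp [IsJointlyHomogeneous, isHomogeneous_zero]

theorem sub (hf : IsJointlyHomogeneous d f) (hg : IsJointlyHomogeneous d g) :
    IsJointlyHomogeneous d (f - g) := by
  rw [IsJointlyHomogeneous, map_sub]
  exact IsHomogeneous.sub hf hg

theorem add (hf : IsJointlyHomogeneous d f) (hg : IsJointlyHomogeneous d g) :
    IsJointlyHomogeneous d (f + g) := by
  rw [IsJointlyHomogeneous, map_add]
  exact IsHomogeneous.add hf hg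

theorem mul (hf : IsJointlyHomogeneous d f) (hg : IsJointlyHomogeneous e g) :
    IsJointlyHomogeneous (d + e) (f * g) := by
  rw [IsJointlyHomogeneous, map_mul]
  exact IsHomogeneous.mul hf hg

theorem X (i : ℕ) : IsJointlyHomogeneous 1 (X i) := by
  rw [IsJointlyHomogeneous, sumAlgEquiv_symm_X]
  exact isHomogeneous_X _ _

theorem C_X (i : ℕ) : IsJointlyHomogeneous 1 (C (MvPolynomial.X i)) := by
  rw [IsJointlyHomogeneous, sumAlgEquiv_symm_C_X]
  exact isHomogeneous_X _ _

theorem one : IsJointlyHomogeneous 0 1 := by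
  rw [IsJointlyHomogeneous, map_one]
  exact isHomogeneous_one _ _

theorem of_mul (hf : IsJointlyHomogeneous e f) (hf0 : f ≠ 0)
    (h : IsJointlyHomogeneous (e + d) (f * g)) : IsJointlyHomogeneous d g := by
  rw [IsJointlyHomogeneous, map_mul] at h
  exact isHomogeneous_of_mul hf (by simpa using hf0) h

theorem map (φ : PolyRing →+* PolyRing)
    (hX : ∀ i, IsJointlyHomogeneous 1 (φ (MvPolynomial.X i)))
    (hC : ∀ i, IsJointlyHomogeneous 1 (φ (C (MvPolynomial.X i))))
    (hf : IsJointlyHomogeneous d f) : IsJointlyHomogeneous d (φ f) := by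
  -- `φ` need not be linear over `ℤ[t]`. Transported to one polynomial ring over `ℤ`, it becomes a
  -- substitution of linear forms.
  let ψ : MvPolynomial (ℕ ⊕ ℕ) ℤ →ₐ[ℤ] MvPolynomial (ℕ ⊕ ℕ) ℤ :=
    ((sumAlgEquiv ℤ ℕ ℕ).symm.toAlgHom.comp φ.toIntAlgHom).comp (sumAlgEquiv ℤ ℕ ℕ).toAlgHom
  have hψ : ∀ p, ψ p = (sumAlgEquiv ℤ ℕ ℕ).symm (φ (sumAlgEquiv ℤ ℕ ℕ p)) := fun _ => rfl
  have h1 : (sumAlgEquiv ℤ ℕ ℕ).symm (φ f) = ψ ((sumAlgEquiv ℤ ℕ ℕ).symm f) := by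
    rw [hψ, AlgEquiv.apply_symm_apply]
  have h2 : ψ = aeval fun v => ψ (MvPolynomial.X v) := MvPolynomial.algHom_ext fun v => by simp
  rw [IsJointlyHomogeneous, h1, h2]
  have := IsHomogeneous.aeval (R := ℤ) hf (fun v => ψ (MvPolynomial.X v)) (n := 1) ?_
  · simpa using this
  · rintro (i | i)
    · simpa [hψ, IsJointlyHomogeneous] using hX i
    · simpa [hψ, IsJointlyHomogeneous] using hC i

theorem C_tHat (A : Finset ℕ) (i : ℕ) : IsJointlyHomogeneous 1 (C (tHat A i)) := C_X _

theorem X_sub_C_tHat (A : Finset ℕ) (i : ℕ) :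
    IsJointlyHomogeneous 1 (MvPolynomial.X i - C (tHat A i)) := (X i).sub (C_tHat A i)

theorem rPlus (i : ℕ) (A : Finset ℕ) (hf : IsJointlyHomogeneous d f) :
    IsJointlyHomogeneous d (rPlus i A f) := by
  refine map (DoubleForest.rPlus i A : PolyRing →+* PolyRing) (fun k => ?_) (fun k => ?_) hf
  · rw [RingHom.coe_coe, rPlus_X]
    split_ifs
    exacts [X _, C_tHat _ _, X _]
  · rw [RingHom.coe_coe, rPlus_C]
    exact C_X _

theorem rMinus (i : ℕ) (A : Finset ℕ) (hf : IsJointlyHomogeneous d f) :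
    IsJointlyHomogeneous d (rMinus i A f) := by
  refine map (DoubleForest.rMinus i A : PolyRing →+* PolyRing) (fun k => ?_) (fun k => ?_) hf
  · rw [RingHom.coe_coe, rMinus_X]
    split_ifs
    exacts [X _, C_tHat _ _, X _]
  · rw [RingHom.coe_coe, rMinus_C]
    exact C_X _

theorem trimOp (i : ℕ) (A : Finset ℕ) (hf : IsJointlyHomogeneous (d + 1) f) :
    IsJointlyHomogeneous d (trimOp i A f) := by
  refine of_mul (X_sub_C_tHat A i) (X_sub_C_ne_zero _ _) ?_
  rw [mul_trimOp, add_comm]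
  exact (hf.rPlus i A).sub (hf.rMinus i A)

theorem substT (A : Finset ℕ) (hf : IsJointlyHomogeneous d f) :
    IsJointlyHomogeneous d (substT A f) := by
  refine map (DoubleForest.substT A) (fun k => ?_) (fun k => ?_) hf
  · rw [substT_X]
    exact X _
  · rw [substT_C, rename_X]
    exact C_X _

theorem C_evA (A : Finset ℕ) (hf : IsJointlyHomogeneous d f) :
    IsJointlyHomogeneous d (C (evA A f)) := by
  refine map (C.comp (evA A : PolyRing →+* CoeffRing)) (fun k => ?_) (fun k => ?_) hf
  · simpa [evA] using C_tHat A k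
  · simpa [evA] using C_X k

theorem exists_eq_C (hf : IsJointlyHomogeneous 0 f) : ∃ a, f = C a := by
  rw [IsJointlyHomogeneous, ← totalDegree_zero_iff_isHomogeneous, totalDegree_eq_zero_iff_eq_C] at hf
  exact ⟨C _, by rw [← sumAlgEquiv_C_inl, ← hf, AlgEquiv.apply_symm_apply]⟩

theorem evStar_eq_zero (A : Finset ℕ) {w : List ℕ} (hf : IsJointlyHomogeneous d f)
    (hw : d < w.length) : evStar A w f = 0 := by
  induction w using List.reverseRecOn generalizing A f d with
  | nil => simp at hw
  | append_singleton w i ih =>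
    rw [evStar_append_singleton]
    cases d with
    | zero =>
      obtain ⟨a, rfl⟩ := hf.exists_eq_C
      rw [trimOp_C, evStar_zero]
    | succ d => exact ih _ (hf.trimOp i A) (by simpa using hw)

end IsJointlyHomogeneous

/-! ### Separation of polynomials by the functionals -/

theorem exists_eq_sum_isJointlyHomogeneous (f : PolyRing) :
    ∃ (d : ℕ) (g : ℕ → PolyRing), (∀ k, IsJointlyHomogeneous k (g k)) ∧
      f = ∑ k ∈ Finset.range d, g k := by
  let p := (sumAlgEquiv ℤ ℕ ℕ).symm f
  refine ⟨p.totalDegree + 1, fun k => sumAlgEquiv ℤ ℕ ℕ (homogeneousComponent k p),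
    fun k => ?_, ?_⟩
  · rw [IsJointlyHomogeneous, AlgEquiv.symm_apply_apply]
    exact homogeneousComponent_isHomogeneous k p
  · rw [← map_sum, sum_homogeneousComponent, AlgEquiv.apply_symm_apply]

theorem exists_evStar_eq_zero_of_length (f : PolyRing) :
    ∃ d, ∀ A w, d ≤ w.length → evStar A w f = 0 := by
  obtain ⟨d, g, hg, rfl⟩ := exists_eq_sum_isJointlyHomogeneous f
  refine ⟨d, fun A w hw => ?_⟩
  rw [← evStarLin_apply, map_sum]
  refine Finset.sum_eq_zero fun k hk => (hg k).evStar_eq_zero A ?_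
  rw [Finset.mem_range] at hk
  omega

/-- The operations `[ev ⋆ E_w]_A` jointly separate polynomials. -/
theorem eq_of_evStar_eq {A : Finset ℕ} {f g : PolyRing} (h : ∀ w, evStar A w f = evStar A w g) :
    f = g := by
  suffices main : ∀ (d : ℕ) (A : Finset ℕ) (p : ℕ → PolyRing),
      (∀ k, IsJointlyHomogeneous k (p k)) →
      (∀ w, evStar A w (∑ k ∈ Finset.range d, p k) = 0) → ∑ k ∈ Finset.range d, p k = 0 by
    obtain ⟨d, p, hp, hfg⟩ := exists_eq_sum_isJointlyHomogeneous (f - g)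
    rw [← sub_eq_zero, hfg]
    refine main d A p hp fun w => ?_
    rw [← hfg, evStar_sub, h, sub_self]
  intro d
  induction d with
  | zero => simp
  | succ d ih =>
    intro A p hp hw
    refine eq_zero_of_trimOp_eq_zero (A := A) (fun i => ?_) (hw [])
    -- The degree-zero component is constant and dies, so one fewer component remains.
    have hE : trimOp i A (∑ k ∈ Finset.range (d + 1), p k) =
        ∑ k ∈ Finset.range d, trimOp i A (p (k + 1)) := by
      obtain ⟨a, ha⟩ := (hp 0).exists_eq_C
      rw [Finset.sum_range_succ', trimOp_add, ha, trimOp_C, add_zero]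
      exact map_sum (trimLin i A) _ _
    rw [hE]
    refine ih (starSet {i} A) _ (fun k => (hp (k + 1)).trimOp i A) fun w => ?_
    rw [← hE, ← evStar_append_singleton, hw]

/-! ### Integration and the construction of dual polynomials -/

open IndexedForest

/-- A family `g` satisfying the relations of the family `E_{i,A} f` is of this form. -/
theorem exists_trimOp_eq (A : Finset ℕ) {d : ℕ} (n : ℕ) (g : ℕ → PolyRing)
    (hclosed : ∀ i j, j < i →
      trimOp i (starSet {j} A) (g j) = trimOp j (starSet {i + 1} A) (g (i + 1)))
    (hn : ∀ i, n ≤ i → g i = 0) (hd : ∀ i, IsJointlyHomogeneous d (g i)) :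
    ∃ f, IsJointlyHomogeneous (d + 1) f ∧ ∀ i, trimOp i A f = g i := by
  induction n generalizing g with
  | zero => exact ⟨0, .zero _, fun i => by rw [trimOp_zero, hn i (Nat.zero_le i)]⟩
  | succ n ih =>
    have hsupp : g n ∈ supported CoeffRing (Set.Iio (n + 1)) := by
      refine mem_supported_of_trimOp_eq_zero _ (starSet {n} A) _ fun i hi => ?_
      rw [hclosed i n hi, hn (i + 1) (by omega), trimOp_zero]
    -- `E_n f₁ = g n`, and `E_i f₁ = 0` for `i > n`. Subtracting the derivatives of `f₁` makes the
    -- family vanish from `n` on and keeps it compatible.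
    let f₁ : PolyRing := (X n - C (tHat A n)) * g n
    have hf₁ : IsJointlyHomogeneous (d + 1) f₁ :=
      add_comm 1 d ▸ (IsJointlyHomogeneous.X_sub_C_tHat A n).mul (hd n)
    have hf₁s : f₁ ∈ supported CoeffRing (Set.Iio (n + 1)) :=
      mul_mem (sub_mem (X_mem_supported.2 (Nat.lt_succ_self n)) (Subalgebra.algebraMap_mem _ _))
        hsupp
    obtain ⟨f₂, hf₂, h⟩ : ∃ f, IsJointlyHomogeneous (d + 1) f ∧
        ∀ i, trimOp i A f = g i - trimOp i A f₁ := by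
      refine ih _ (fun i j hij => ?_) (fun i hi => ?_) fun i => (hd i).sub (hf₁.trimOp i A)
      · rw [trimOp_sub, trimOp_sub, hclosed i j hij, trimOp_comm hij]
      · rcases Nat.eq_or_lt_of_le hi with rfl | hi'
        · rw [trimOp_mul_of_mem_supported A hsupp, sub_self]
        · rw [hn i hi', trimOp_eq_zero_of_mem_supported hi' A hf₁s, sub_self]
    exact ⟨f₂ + f₁, hf₂.add hf₁, fun i => by rw [trimOp_add, h, sub_add_cancel]⟩

/-- The product of the elementary forests indexed by a word. -/
noncomputable def wordProd (w : List ℕ) : IndexedForest := (w.map elementary).prod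

theorem wordProd_append_singleton (w : List ℕ) (i : ℕ) :
    wordProd (w ++ [i]) = wordProd w * elementary i := by simp [wordProd]

theorem exists_wordProd_eq (F : IndexedForest) : ∃ w, wordProd w = F := F.trimmingWords_nonempty

open Classical in
/-- The property that `[ev ⋆ E_G] p` is `1` for `G = F` and `0` for `G ≠ F`. -/
def IsDualTo (F : IndexedForest) (p : PolyRing) : Prop :=
  ∀ w, evStar ∅ w p = if wordProd w = F then 1 else 0

open Classical in
theorem IsDualTo.evStar_substT {F : IndexedForest} {p : PolyRing} (hp : IsDualTo F p)
    (A : Finset ℕ) (w : List ℕ) :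
    evStar A w (substT A p) = if wordProd w = F then 1 else 0 := by
  rw [evStar_empty_substT, hp w]
  split_ifs <;> simp

-- The right-hand side of the recursion has the functionals required of `E_i 𝔓_F`, because `G · i =
-- F` means `i ∈ QDes(F)` and `G = F / i`.
open Classical in
theorem IsDualTo.evStar_trimmed {F : IndexedForest} {p : PolyRing} {i : ℕ}
    (hp : i ∈ F.qDes → IsDualTo (F.trim i) p) (w : List ℕ) :
    evStar {i} w (if i ∈ F.qDes then substT {i} p else 0) =
      if wordProd (w ++ [i]) = F then 1 else 0 := by
  simp only [wordProd_append_singleton, mul_elementary_eq_iff]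
  by_cases h : i ∈ F.qDes
  · simp [h, (hp h).evStar_substT]
  · simp [h]

theorem IsDualTo.unique {F : IndexedForest} {p q : PolyRing} (hp : IsDualTo F p)
    (hq : IsDualTo F q) : p = q :=
  eq_of_evStar_eq fun w => (hp w).trans (hq w).symm

theorem isDualTo_one : IsDualTo 1 1 := by
  intro w
  induction w using List.reverseRecOn with
  | nil => simp [wordProd, evStar, evA, starComp]
  | append_singleton w i =>
    rw [evStar_append_singleton, ← map_one C, trimOp_C, evStar_zero, if_neg]
    intro h
    simpa using length_eq_of_prod_eq (w := []) h

theorem exists_isDualTo (v : List ℕ) :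
    ∃ p, IsJointlyHomogeneous v.length p ∧ IsDualTo (wordProd v) p := by
  classical
  obtain ⟨n, hn⟩ : ∃ n, n = v.length := ⟨_, rfl⟩
  rw [← hn]
  induction n generalizing v with
  | zero =>
    rw [List.length_eq_zero_iff.1 hn.symm]
    exact ⟨1, .one, isDualTo_one⟩
  | succ n ih =>
    obtain ⟨F, hF⟩ : ∃ F, F = wordProd v := ⟨_, rfl⟩
    rw [← hF]
    have hp : ∀ i, ∃ p, IsJointlyHomogeneous n p ∧ (i ∈ F.qDes → IsDualTo (F.trim i) p) := by
      intro i
      by_cases hi : i ∈ F.qDes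
      · obtain ⟨u, hu⟩ := exists_wordProd_eq (F.trim i)
        have hl : (u ++ [i]).length = v.length := by
          apply length_eq_of_prod_eq
          change wordProd (u ++ [i]) = wordProd v
          rw [wordProd_append_singleton, hu, trim_mul_elementary_of_mem_qDes hi, hF]
        obtain ⟨p, h1, h2⟩ := ih u (by simp at hl; omega)
        exact ⟨p, h1, fun _ => hu ▸ h2⟩
      · exact ⟨0, .zero n, fun h => absurd h hi⟩
    choose p hhom hdual using hp
    let g : ℕ → PolyRing := fun i => if i ∈ F.qDes then substT {i} (p i) else 0
    have hg : ∀ i w, evStar {i} w (g i) = if wordProd (w ++ [i]) = F then 1 else 0 :=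
      fun i w => IsDualTo.evStar_trimmed (hdual i) w
    obtain ⟨N, hN⟩ := exists_qDes_lt F
    obtain ⟨f, hf, hfg⟩ : ∃ f, IsJointlyHomogeneous (n + 1) f ∧ ∀ i, trimOp i ∅ f = g i := by
      refine exists_trimOp_eq ∅ N g (fun i j hij => ?_)
        (fun i hi => if_neg fun h => (hN i h).not_ge hi) (fun i => ?_)
      -- By separation, compatibility of the `g i` reduces to `w · i · j = w · j · (i + 1)` in the
      -- monoid.
      · refine eq_of_evStar_eq (A := starSet {i} (starSet {j} ∅)) fun w => ?_
        rw [← evStar_append_singleton, starSet_comm hij, ← evStar_append_singleton,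
          starSet_empty, starSet_empty, hg, hg]
        simp only [wordProd_append_singleton, mul_assoc, elementary_mul_elementary hij]
      · by_cases hi : i ∈ F.qDes
        · simpa only [g, if_pos hi] using (hhom i).substT {i}
        · simpa only [g, if_neg hi] using IsJointlyHomogeneous.zero n
    -- The correction makes the empty-word functional vanish and is invisible to every `E_i`; its
    -- degree is that of `f`, so homogeneity survives.
    refine ⟨f - C (evA ∅ f), hf.sub (hf.C_evA ∅), fun w => ?_⟩
    induction w using List.reverseRecOn with
    | nil =>
      rw [if_neg]
      · simp [evStar, starComp, starWeight, evA]
      · rw [hF]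
        intro h
        have := length_eq_of_prod_eq (v := []) h
        simp at this
        omega
    | append_singleton w i =>
      rw [evStar_append_singleton, trimOp_sub, trimOp_C, sub_zero, hfg, starSet_empty, hg]

/-! ### The double forest family and the expansion -/

theorem IsDoubleForestFamily.isDualTo {P : IndexedForest → PolyRing}
    (hP : IsDoubleForestFamily P) (F : IndexedForest) : IsDualTo F (P F) := by
  classical
  intro w
  induction w using List.reverseRecOn generalizing F with
  | nil =>
    refine (hP.normalization F).trans ?_
    simp [wordProd, eq_comm]
  | append_singleton w i ih =>
    rw [evStar_append_singleton, hP.recursion, starSet_empty, wordProd_append_singleton]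
    simp only [mul_elementary_eq_iff]
    by_cases hi : i ∈ F.qDes
    · simp only [hi, true_and, if_true]
      rw [evStar_empty_substT, ih]
      split_ifs <;> simp
    · simp [hi]

theorem exists_isDoubleForestFamily : ∃ P, IsDoubleForestFamily P := by
  classical
  have hex : ∀ F, ∃ p, IsHomog p ∧ IsDualTo F p := by
    intro F
    obtain ⟨v, rfl⟩ := exists_wordProd_eq F
    obtain ⟨p, h1, h2⟩ := exists_isDualTo v
    exact ⟨p, ⟨_, h1⟩, h2⟩
  choose P hhom hdual using hex
  refine ⟨P, hhom, fun F => ?_, fun F i => ?_⟩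
  · refine (hdual F []).trans ?_
    simp [wordProd, eq_comm]
  · refine eq_of_evStar_eq (A := {i}) fun w => ?_
    rw [IsDualTo.evStar_trimmed (fun _ => hdual (F.trim i)), ← hdual F (w ++ [i]),
      evStar_append_singleton, starSet_empty]

theorem isDoubleForestFamily_doubleForest : IsDoubleForestFamily doubleForest :=
  Classical.epsilon_spec exists_isDoubleForestFamily

theorem evStar_eq_evStarForest (w : List ℕ) (f : PolyRing) :
    evStar ∅ w f = evStarForest (wordProd w) f :=
  evStar_eq_of_prod_eq ∅ f (wordProd w).trimmingWords_nonempty.choose_spec.symm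

theorem finite_evStarForest_ne_zero (f : PolyRing) :
    {F : IndexedForest | evStarForest F f ≠ 0}.Finite := by
  obtain ⟨d, hd⟩ := exists_evStar_eq_zero_of_length f
  obtain ⟨n, hn⟩ := exists_mem_supported f
  -- A nonzero functional needs a word shorter than `d` with all letters below `n`; only finitely
  -- many exist.
  refine ((List.finite_length_lt (Fin n) d).image
    fun w => wordProd (w.map Fin.val)).subset fun F hF => ?_
  obtain ⟨w, rfl⟩ := exists_wordProd_eq F
  have hw : evStar ∅ w f ≠ 0 := by
    rw [evStar_eq_evStarForest]
    exact hF
  have hlt : ∀ i ∈ w, i < n := fun i hi => by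
    by_contra h
    exact hw (evStar_eq_zero_of_mem_supported hn ⟨i, hi, not_lt.1 h⟩)
  obtain ⟨u, rfl⟩ : ∃ u : List (Fin n), u.map Fin.val = w := by
    rw [← Set.mem_range, Set.range_list_map]
    intro i hi
    exact ⟨⟨i, hlt i hi⟩, rfl⟩
  refine ⟨u, ?_, rfl⟩
  by_contra h
  exact hw (hd _ _ (by simpa using h))

theorem eq_finsum_evStarForest (f : PolyRing) :
    f = ∑ᶠ F : IndexedForest, evStarForest F f • doubleForest F := by
  classical
  have hfin := finite_evStarForest_ne_zero f
  rw [finsum_eq_sum_of_support_subset (s := hfin.toFinset) _ fun F hF => by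
    simpa using left_ne_zero_of_smul hF]
  -- By duality, only the term of the forest factorized by `w` survives on the right.
  refine eq_of_evStar_eq (A := ∅) fun w => ?_
  rw [← evStarLin_apply ∅ w (∑ _ ∈ _, _), map_sum]
  simp only [map_smul, evStarLin_apply, isDoubleForestFamily_doubleForest.isDualTo _ w,
    smul_eq_mul, mul_ite, mul_one, mul_zero, Finset.sum_ite_eq, Set.Finite.mem_toFinset,
    Set.mem_ofPred_eq]
  rw [evStar_eq_evStarForest]
  split_ifs with h
  · rfl
  · exact not_not.1 h

end DoubleForest

open DoubleForest
theorem theorem10p5 :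
    -- the double forest polynomials are well defined
    (IsDoubleForestFamily doubleForest ∧
      ∀ P : IndexedForest → PolyRing, IsDoubleForestFamily P → P = doubleForest) ∧
    -- the operator `[ev ⋆ E_F]` can be computed along any factorization of `F`
    (∀ (F : IndexedForest), ∀ w ∈ F.trimmingWords, ∀ f : PolyRing,
      evStar ∅ w f = evStarForest F f) ∧
    -- the expansion, a finite sum
    ∀ f : PolyRing, {F : IndexedForest | evStarForest F f ≠ 0}.Finite ∧
      f = ∑ᶠ F : IndexedForest, evStarForest F f • doubleForest F := by
  refine ⟨⟨isDoubleForestFamily_doubleForest, fun P hP => ?_⟩, ?_, fun f =>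
    ⟨finite_evStarForest_ne_zero f, eq_finsum_evStarForest f⟩⟩
  · funext F
    exact (hP.isDualTo F).unique (isDoubleForestFamily_doubleForest.isDualTo F)
  · rintro F w rfl f
    exact evStar_eq_evStarForest w f
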